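/- Let $\mathcal{X}$ be a measurable space. A regression algorithm $\mathcal{A}$ maps a data set $\mathcal{D}\in(\mathcal{X}\times\mathbb{R})^n$ of any size $n\ge 0$ to a fitted function $\mathcal{A}(\mathcal{D}):\mathcal{X}\to\mathbb{R}$; it does not depend on the order of the data points, and $\mathcal{A}(\mathcal{D})(x)$ is measurable in $(\mathcal{D},x)$. Given such a base algorithm $\mathcal{A}$ and integers $N,B\ge 1$, its subbagged version $\mathcal{A}_{\mathrm{bag}}$ is the following randomized algorithm: for a data set $\mathcal{D}=\{(X_i,Y_i)\}_{i\in[n]}$ with $n\ge N$, draw $B$ independent bags, independently of the data, where bag $b$ is a sequence of indices $i^{(b)}_1,\dots,i^{(b)}_N$ drawn uniformly at random without replacement from $[n]=\{1,\dots,n\}$, and return the averaged prediction $$\widehat\mu(x)=\frac1B\sum_{b=1}^B\widehat\mu^{(b)}(x),\qquad \widehat\mu^{(b)}=\mathcal{A}\big(\{(X_{i^{(b)}_j},Y_{i^{(b)}_j})\}_{j\in[N]}\big).$$ For a probability distribution $P$ on $\mathcal{X}\times\mathbb{R}$, the out-of-sample $m$-stability of $\mathcal{A}_{\mathrm{bag}}$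 at sample size $n$ is $$\beta^{\mathrm{out}}_{m,n}(\mathcal{A}_{\mathrm{bag}},P)=\mathbb{E}\big[\,|\widehat\mu_n(X)-\widehat\mu_{n+m}(X)|\,\big],$$ where $\widehat\mu_n$ and $\widehat\mu_{n+m}$ are the outputs of $\mathcal{A}_{\mathrm{bag}}$ on $(X_1,Y_1),\dots,(X_n,Y_n)$ and on $(X_1,Y_1),\dots,(X_{n+m},Y_{n+m})$ respectively, and the expectation is over $(X_1,Y_1),\dots,(X_{n+m},Y_{n+m}),(X,Y)\stackrel{\mathrm{iid}}{\sim}P$ and over the bags of the two runs. The bags of the two runs are jointly independent of all data points, and each run's bags have the distribution described above; the joint distribution of the two collections of bags (for example, independent) is otherwise arbitrary. Proposition. Suppose that $\mathcal{A}$ returns outputs lying in $[0,1]$, that is, $\mathcal{A}(\mathcal{D})(x)\in[0,1]$ for all data sets $\mathcal{D}$ and all $x\in\mathcal{X}$. Then for any probability distribution $P$ on $\mathcal{X}\times\mathbb{R}$, any $m\ge 1$, any $B\ge 1$, any $1\le N<n$, and any such joint distribution of the bags of the two runs, $$\beta^{\mathrm{out}}_{m,n}(\mathcal{A}_{\mathrm{bag}},P)\le\sqrt{\frac{m}{4n}\cdot\frac{N}{n+1-N}}+\frac{1}{\sqrt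 B}.$$ -/

import Mathlib

open MeasureTheory ProbabilityTheory
open scoped ENNReal

/-- A (deterministic) regression algorithm: it takes a training data set of any size `n`, a family
of `n` pairs `(X, Y)`, and returns a fitted function `𝒳 → ℝ`. The prediction is measurable, jointly
in the data set and the test point, and the algorithm is symmetric in the training data. -/
structure RegressionAlgorithm (𝒳 : Type*) [MeasurableSpace 𝒳] where
  fit : (n : ℕ) → (Fin n → 𝒳 × ℝ) → 𝒳 → ℝ
  measurable_fit : ∀ n, Measurable fun q : (Fin n → 𝒳 × ℝ) × 𝒳 => fit n q.1 q.2
  symmetric : ∀ (n : ℕ) (π : Equiv.Perm (Fin n)) (D : Fin n → 𝒳 × ℝ), fit n (D ∘ π) = fit n D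

/-- A randomized regression algorithm, defined for data sets of size at least `minSize`: on a data
set of size `n` it draws an internal random seed from the probability measure `law n`, independently
of the data, and returns a function of the data set and of the seed. -/
structure RandomizedAlgorithm (𝒳 : Type*) [MeasurableSpace 𝒳] where
  minSize : ℕ
  Seed : ℕ → Type
  seedSpace : ∀ n, MeasurableSpace (Seed n)
  law : ∀ n, Measure (Seed n)
  prob_law : ∀ n, minSize ≤ n → IsProbabilityMeasure (law n)
  fit : (n : ℕ) → (Fin n → 𝒳 × ℝ) → Seed n → 𝒳 → ℝ
  measurable_fit : ∀ n,
    Measurable fun q : ((Fin n → 𝒳 × ℝ) × Seed n) × 𝒳 => fit n q.1.1 q.1.2 q.2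

attribute [instance] RandomizedAlgorithm.seedSpace

/-- `π` is a possible joint law of the internal seeds of two runs of the algorithm, one on a data
set of size `n` and one on a data set of size `n'`: each seed has its prescribed law. -/
def RandomizedAlgorithm.IsSeedCoupling {𝒳 : Type*} [MeasurableSpace 𝒳]
    (𝒜 : RandomizedAlgorithm 𝒳) (n n' : ℕ) (π : Measure (𝒜.Seed n × 𝒜.Seed n')) : Prop :=
  π.map Prod.fst = 𝒜.law n ∧ π.map Prod.snd = 𝒜.law n'

/-- Out-of-sample `m`-stability at sample size `n`: the expectation of `|μ̂ₙ(X) - μ̂ₙ₊ₘ(X)|`, where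
`μ̂ₙ` is fitted to the first `n` and `μ̂ₙ₊ₘ` to all of the `n + m` training points, the training
points and the test point `(X, Y)` are i.i.d. from `P`, and the two seeds have joint law `π`
and are independent of all data points. -/
noncomputable def RandomizedAlgorithm.outStability {𝒳 : Type*} [MeasurableSpace 𝒳]
    (𝒜 : RandomizedAlgorithm 𝒳) (P : Measure (𝒳 × ℝ)) (m n : ℕ)
    (π : Measure (𝒜.Seed n × 𝒜.Seed (n + m))) : ℝ≥0∞ :=
  ∫⁻ ω : ((Fin (n + m) → 𝒳 × ℝ) × (𝒳 × ℝ)) × (𝒜.Seed n × 𝒜.Seed (n + m)),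
    ENNReal.ofReal
      |𝒜.fit n (fun i : Fin n => ω.1.1 (Fin.castAdd m i)) ω.2.1 ω.1.2.1
        - 𝒜.fit (n + m) ω.1.1 ω.2.2 ω.1.2.1|
    ∂(((Measure.pi fun _ : Fin (n + m) => P).prod P).prod π)

/-- A bag: a sequence of `N` pairwise distinct indices among `n`. -/
abbrev Bag (N n : ℕ) : Type := Fin N ↪ Fin n

instance Bag.measurableSpace (N n : ℕ) : MeasurableSpace (Bag N n) := ⊤

instance Bag.discreteMeasurableSpace (N n : ℕ) : DiscreteMeasurableSpace (Bag N n) :=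
  ⟨fun _ => trivial⟩

/-- The law of `B` independent bags, each of them `N` indices drawn uniformly at random without
replacement from `n` indices (used for `N ≤ n`). -/
noncomputable def bagsLaw (N B n : ℕ) : Measure (Fin B → Bag N n) :=
  Measure.pi fun _ : Fin B => uniformOn (Set.univ : Set (Bag N n))

/-- The subbagged version of a base algorithm, with `B` bags of size `N`: the average of the `B`
models that the base algorithm returns on the bags. -/
noncomputable def RegressionAlgorithm.bag {𝒳 : Type*} [MeasurableSpace 𝒳]
    (𝒜 : RegressionAlgorithm 𝒳) (N B : ℕ) : RandomizedAlgorithm 𝒳 where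
  minSize := N
  Seed n := Fin B → Bag N n
  seedSpace _ := inferInstance
  law n := bagsLaw N B n
  prob_law n hn := by
    have : Nonempty (Bag N n) := ⟨Fin.castLEEmb hn⟩
    have : IsProbabilityMeasure (uniformOn (Set.univ : Set (Bag N n))) :=
      isProbabilityMeasure_uniformOn Set.finite_univ Set.univ_nonempty
    unfold bagsLaw
    infer_instance
  fit _ D I x := (1 / (B : ℝ)) * ∑ b : Fin B, 𝒜.fit N (fun j => D (I b j)) x
  measurable_fit n := by
    have h : Measurable fun q : ((Fin n → 𝒳 × ℝ) × 𝒳) × (Fin B → Bag N n) =>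
        (1 / (B : ℝ)) * ∑ b : Fin B, 𝒜.fit N (fun j => q.1.1 (q.2 b j)) q.1.2 := by
      refine measurable_from_prod_countable_left fun I => ?_
      refine (Finset.measurable_sum _ fun b _ => ?_).const_mul _
      refine (𝒜.measurable_fit N).comp (Measurable.prodMk ?_ measurable_snd)
      exact measurable_pi_lambda _ fun j =>
        (measurable_pi_apply (I b j)).comp (measurable_fst (α := Fin n → 𝒳 × ℝ) (β := 𝒳))
    exact h.comp ((measurable_fst.fst.prodMk measurable_snd).prodMk measurable_fst.snd)

/-! Let `U_k` denote the average of the base algorithm over all bags of size `N` from `k` points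
(`bagAverage`), a complete U-statistic. Given the data and the test point, the bagged prediction is
a mean of `B` independent draws from `[0,1]` with expectation `U_k`, so each run costs at most
`1/(2√B)` in `L¹`; this uses only the marginal law of its seed.

It remains to bound `U_n - U_{n+m}` in `L²`, with the test point fixed. By exchangeability `U_M` is
the projection of `U_k` onto symmetric functions of the `M` points, whence `E(U_k - U_M)² = E U_k² -
E U_M²` (`integral_sq_bagAverage_sub`). These decrements telescope, and a single one is the mean
square of a leave-one-out difference. Its average over the omitted index obeys a deterministic bound
(`Bag.sum_sq_jackknife_le`), obtained from Cauchy–Schwarz and the incidence structure of bags and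
avoided indices. -/

/-! ### Combinatorics of bags and the deterministic jackknife bound. -/

lemma Bag.card_filter_mem {N M : ℕ} (s : Finset (Fin M)) :
    (Finset.univ.filter fun J : Bag N M => ∀ j, J j ∈ s).card = s.card.descFactorial N := by
  let e : {J : Bag N M // ∀ j, J j ∈ s} ≃ (Fin N ↪ s) :=
    { toFun := fun J => ⟨fun j => ⟨J.1 j, J.2 j⟩, fun a b h => J.1.injective (Subtype.ext_iff.1 h)⟩
      invFun := fun J => ⟨J.trans (Function.Embedding.subtype _), fun j => (J j).2⟩
      left_inv := fun J => by ext; rfl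
      right_inv := fun J => by ext; rfl }
  rw [← Fintype.card_subtype, Fintype.card_congr e, Fintype.card_embedding_eq]
  simp

/-- Lets a leave-one-out average be handled as a sum over bags of the full index set. -/
lemma Bag.sum_comp_succAbove {N k : ℕ} (i : Fin (k + 1)) (f : Bag N (k + 1) → ℝ) :
    ∑ I : Bag N k, f (I.trans i.succAboveEmb)
      = ∑ J : Bag N (k + 1), if ∀ j, J j ≠ i then f J else 0 := by
  rw [← Finset.sum_filter]
  refine Finset.sum_bij (fun I _ => I.trans i.succAboveEmb) ?_ ?_ ?_ (fun _ _ => rfl)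
  · intro I _
    simp [Fin.succAbove_ne]
  · intro I _ I' _ h
    ext j : 1
    exact Fin.succAbove_right_injective (DFunLike.congr_fun h j)
  · intro J hJ
    have hJ' : ∀ j, J j ≠ i := by simpa using hJ
    choose g hg using fun j => Fin.exists_succAbove_eq (hJ' j)
    refine ⟨⟨g, fun a b h => J.injective (by rw [← hg a, ← hg b, h])⟩, Finset.mem_univ _, ?_⟩
    ext j : 1
    exact hg j

/-- The averages of `g` over the bags that avoid a given index differ little, in mean square over
the index, from its average over all bags. -/
lemma Bag.sum_sq_jackknife_le {N k : ℕ} (hk : 1 ≤ k) (hNk : N ≤ k)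
    (g : Bag N (k + 1) → ℝ) (hg : ∀ J, g J ^ 2 ≤ 1 / 4) :
    ∑ i : Fin (k + 1),
      ((∑ J, if ∀ j, J j ≠ i then g J else 0) / (k.descFactorial N : ℝ)
        - (∑ J, g J) / ((k + 1).descFactorial N : ℝ)) ^ 2
      ≤ (k + 1) * N / (4 * k * (k + 1 - N)) := by
  classical
  set T : ℝ := ((k + 1).descFactorial N : ℝ) with hT
  set T' : ℝ := (k.descFactorial N : ℝ) with hT'
  set T'' : ℝ := ((k - 1).descFactorial N : ℝ) with hT''
  have hTpos : 0 < T := by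
    rw [hT]; exact_mod_cast Nat.descFactorial_pos.2 (by omega)
  have hTpos' : 0 < T' := by
    rw [hT']; exact_mod_cast Nat.descFactorial_pos.2 hNk
  have hkpos : (0 : ℝ) < k := by exact_mod_cast hk
  have hNk' : (N : ℝ) ≤ k := by exact_mod_cast hNk
  have hpos : (0 : ℝ) < k + 1 - N := by linarith
  -- `e1` and `e2` both come from expanding a falling factorial of length `N + 1` at either end. In
  -- the case `N = k` both sides of `e2` vanish.
  have e1 : (k + 1) * T' = (k + 1 - N) * T := by
    have := (Nat.succ_descFactorial_succ k N).symm.trans (Nat.descFactorial_succ (k + 1) N)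
    have h2 := congrArg (Nat.cast : ℕ → ℝ) this
    push_cast [Nat.cast_sub (show N ≤ k + 1 by omega)] at h2
    exact h2
  have e2 : k * T'' = (k - N) * T' := by
    obtain ⟨l, rfl⟩ : ∃ l, k = l + 1 := ⟨k - 1, by omega⟩
    have := (Nat.succ_descFactorial_succ l N).symm.trans (Nat.descFactorial_succ (l + 1) N)
    have h2 := congrArg (Nat.cast : ℕ → ℝ) this
    push_cast [Nat.cast_sub hNk] at h2
    simpa [hT'', hT'] using h2
  -- Incidence matrix of "bag `J` avoids index `i`"; `a1` to `a4` give its column sums, row sums and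
  -- Gram matrix.
  let a : Bag N (k + 1) → Fin (k + 1) → ℝ := fun J i => if ∀ j, J j ≠ i then 1 else 0
  have a1 : ∀ i, ∑ J, a J i = T' := by
    intro i
    have := Bag.card_filter_mem (N := N) ({i}ᶜ : Finset (Fin (k + 1)))
    simp only [Finset.mem_compl, Finset.mem_singleton, Finset.card_compl, Fintype.card_fin,
      Finset.card_singleton, Nat.add_sub_cancel] at this
    simp only [a, Finset.sum_boole, this, hT', ne_eq]
  have a2 : ∀ J, ∑ i, a J i = k + 1 - N := by
    intro J
    have h1 : (Finset.univ.filter fun i => ∀ j, J j ≠ i) = (Finset.univ.map J)ᶜ := by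
      ext i; simp
    simp only [a, Finset.sum_boole, h1, Finset.card_compl, Finset.card_map, Finset.card_univ,
      Fintype.card_fin]
    push_cast [Nat.cast_sub (show N ≤ k + 1 by omega)]
    rfl
  have a3 : ∀ i i', i ≠ i' → ∑ J, a J i * a J i' = T'' := by
    intro i i' hii
    have := Bag.card_filter_mem (N := N) ({i, i'}ᶜ : Finset (Fin (k + 1)))
    rw [Finset.card_compl, Finset.card_pair hii, Fintype.card_fin,
      show k + 1 - 2 = k - 1 by omega] at this
    rw [hT'', ← this, Finset.card_filter]
    push_cast
    refine Finset.sum_congr rfl fun J _ => ?_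
    simp only [a, ← ite_and, mul_ite, mul_one, mul_zero, Finset.mem_compl, Finset.mem_insert,
      Finset.mem_singleton, not_or, forall_and, ne_eq]
    congr 1
    exact propext and_comm
  have a4 : ∀ i, ∑ J, a J i * a J i = T' := by
    intro i
    rw [← a1 i]
    refine Finset.sum_congr rfl fun J _ => ?_
    simp only [a]; split_ifs <;> simp
  set d : Fin (k + 1) → ℝ := fun i =>
    (∑ J, if ∀ j, J j ≠ i then g J else 0) / T' - (∑ J, g J) / T with hd
  have hd' : ∀ i, d i = (∑ J, a J i * g J) / T' - (∑ J, g J) / T := by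
    intro i; simp only [hd, a, ite_mul, one_mul, zero_mul]
  have d0 : ∑ i, d i = 0 := by
    simp only [hd', Finset.sum_sub_distrib, ← Finset.sum_div]
    rw [Finset.sum_comm]
    simp only [← Finset.sum_mul, a2, ← Finset.mul_sum, Finset.sum_const, Finset.card_univ,
      Fintype.card_fin, nsmul_eq_mul]
    push_cast
    field_simp
    linear_combination (-(∑ J, g J)) * e1
  set S := ∑ i, d i ^ 2 with hS
  let w : Bag N (k + 1) → ℝ := fun J => ∑ i, a J i * d i
  -- Since `∑ d = 0`, the centering constant drops out, which makes `S` linear in `g`.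
  have s1 : S * T' = ∑ J, g J * w J := by
    have h1 : ∑ J, g J * w J = ∑ i, d i * ∑ J, a J i * g J := by
      simp only [w, Finset.mul_sum]
      rw [Finset.sum_comm]
      exact Finset.sum_congr rfl fun i _ => Finset.sum_congr rfl fun J _ => by ring
    have h2 : ∀ i, ∑ J, a J i * g J = T' * d i + T' * ((∑ J, g J) / T) := by
      intro i; rw [hd' i]; field_simp; ring
    rw [h1]
    simp only [h2, mul_add, Finset.sum_add_distrib, ← Finset.sum_mul, d0, hS]
    rw [zero_mul, add_zero, Finset.sum_mul]
    exact Finset.sum_congr rfl fun i _ => by ring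
  -- The Gram matrix is `T''` in every entry plus `T' - T''` on the diagonal; the constant part
  -- annihilates `d` because `∑ d = 0`.
  have s2 : ∑ J, w J ^ 2 = (T' - T'') * S := by
    have h1 : ∀ i i', ∑ J, a J i * a J i' = T'' + if i = i' then T' - T'' else 0 := by
      intro i i'
      split_ifs with h
      · subst h; rw [a4]; ring
      · rw [a3 i i' h]; ring
    have h2 : ∑ J, w J ^ 2 = ∑ i, ∑ i', d i * d i' * ∑ J, a J i * a J i' := by
      simp only [w, sq, Finset.sum_mul_sum]
      rw [Finset.sum_comm]
      refine Finset.sum_congr rfl fun i _ => ?_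
      rw [Finset.sum_comm]
      refine Finset.sum_congr rfl fun i' _ => ?_
      rw [Finset.mul_sum]
      exact Finset.sum_congr rfl fun J _ => by ring
    rw [h2]
    simp only [h1, mul_add, Finset.sum_add_distrib, mul_ite, mul_zero, Finset.sum_ite_eq,
      Finset.mem_univ, if_true]
    have h3 : ∑ i, ∑ i', d i * d i' * T'' = 0 := by
      simp only [← Finset.sum_mul, ← Finset.mul_sum, d0]; simp
    rw [h3, hS, Finset.mul_sum, zero_add]
    exact Finset.sum_congr rfl fun i _ => by ring
  have s3 : ∑ J, g J ^ 2 ≤ T / 4 := by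
    calc ∑ J, g J ^ 2 ≤ ∑ _J : Bag N (k + 1), (1 / 4 : ℝ) := Finset.sum_le_sum fun J _ => hg J
      _ = T / 4 := by
        simp only [Finset.sum_const, Finset.card_univ, Fintype.card_embedding_eq,
          Fintype.card_fin, nsmul_eq_mul, hT]
        ring
  have hS0 : 0 ≤ S := Finset.sum_nonneg fun i _ => sq_nonneg _
  have hTT : k * (T' - T'') = N * T' := by linear_combination -e2
  have hTT0 : 0 ≤ T' - T'' := by
    have : 0 ≤ k * (T' - T'') := by rw [hTT]; positivity
    exact nonneg_of_mul_nonneg_right this hkpos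
  have s4 : (S * T') ^ 2 ≤ T / 4 * ((T' - T'') * S) := by
    rw [s1, ← s2]
    exact (Finset.sum_mul_sq_le_sq_mul_sq _ _ _).trans
      (mul_le_mul_of_nonneg_right s3 (Finset.sum_nonneg fun J _ => sq_nonneg _))
  rw [le_div_iff₀ (by positivity)]
  -- The Cauchy–Schwarz bound is quadratic in `S` on the left and linear on the right, so a factor
  -- `S * T'` is cancelled, which needs `S > 0`.
  rcases hS0.eq_or_lt with h0 | h0
  · rw [← h0, zero_mul]; positivity
  have s5 : S * T' * k ≤ T / 4 * N := by
    have : (S * T') * (S * T' * k) ≤ (S * T') * (T / 4 * N) := by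
      calc (S * T') * (S * T' * k) = k * (S * T') ^ 2 := by ring
        _ ≤ k * (T / 4 * ((T' - T'') * S)) := mul_le_mul_of_nonneg_left s4 hkpos.le
        _ = T / 4 * S * (k * (T' - T'')) := by ring
        _ = _ := by rw [hTT]; ring
    exact le_of_mul_le_mul_left this (by positivity)
  have s6 : T * (S * (4 * k * (k + 1 - N))) ≤ T * ((k + 1) * N) := by
    calc T * (S * (4 * k * (k + 1 - N))) = 4 * S * k * ((k + 1 - N) * T) := by ring
      _ = 4 * (k + 1) * (S * T' * k) := by rw [← e1]; ring
      _ ≤ 4 * (k + 1) * (T / 4 * N) := mul_le_mul_of_nonneg_left s5 (by positivity)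
      _ = _ := by ring
  exact le_of_mul_le_mul_left s6 hTpos

/-! ### Second moments of the complete bag average. -/

/-- The average of `h` over all bags of size `N` drawn from the data set `z`. -/
noncomputable def bagAverage {Z : Type*} {N : ℕ} (h : (Fin N → Z) → ℝ) (k : ℕ) (z : Fin k → Z) :
    ℝ :=
  (∑ I : Bag N k, h fun j => z (I j)) / (k.descFactorial N : ℝ)

lemma measurePreserving_comp_embedding {Z : Type*} [MeasurableSpace Z] (P : Measure Z)
    [IsProbabilityMeasure P] {k M : ℕ} (e : Fin k ↪ Fin M) :
    MeasurePreserving (fun (z : Fin M → Z) i => z (e i))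
      (Measure.pi fun _ => P) (Measure.pi fun _ => P) := by
  refine ⟨by fun_prop, ?_⟩
  have h1 : iIndepFun (fun (i : Fin M) (z : Fin M → Z) => z i) (Measure.pi fun _ => P) :=
    iIndepFun_pi (X := fun _ => id) fun _ => aemeasurable_id
  have h2 := (h1.precomp e.injective).map_fun_eq_pi_map
    (fun i => (measurable_pi_apply _).aemeasurable)
  rw [h2]
  congr with i : 1
  rw [(measurePreserving_eval (fun _ : Fin M => P) (e i)).map_eq]

lemma integral_pi_comp_embedding {Z : Type*} [MeasurableSpace Z] (P : Measure Z)
    [IsProbabilityMeasure P] {k M : ℕ} (e : Fin k ↪ Fin M) {f : (Fin k → Z) → ℝ}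
    (hf : Measurable f) :
    ∫ z, f (fun i => z (e i)) ∂(Measure.pi fun _ : Fin M => P)
      = ∫ z, f z ∂(Measure.pi fun _ : Fin k => P) := by
  have mp := measurePreserving_comp_embedding P e
  rw [← mp.map_eq, integral_map mp.measurable.aemeasurable hf.aestronglyMeasurable]

section BagAverage

variable {Z : Type*} {N : ℕ} {h : (Fin N → Z) → ℝ}

lemma bagAverage_mem_Icc (h01 : ∀ z, h z ∈ Set.Icc (0 : ℝ) 1) (k : ℕ) (z : Fin k → Z) :
    bagAverage h k z ∈ Set.Icc (0 : ℝ) 1 := by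
  refine ⟨div_nonneg (Finset.sum_nonneg fun I _ => (h01 _).1) (Nat.cast_nonneg _),
    div_le_one_of_le₀ ?_ (Nat.cast_nonneg _)⟩
  calc ∑ I : Bag N k, h (fun j => z (I j)) ≤ ∑ _I : Bag N k, (1 : ℝ) :=
        Finset.sum_le_sum fun I _ => (h01 _).2
    _ = _ := by simp [Fintype.card_embedding_eq]

lemma bagAverage_comp_perm (k : ℕ) (σ : Equiv.Perm (Fin k)) (z : Fin k → Z) :
    bagAverage h k (fun i => z (σ i)) = bagAverage h k z := by
  unfold bagAverage
  congr 1
  exact Fintype.sum_equiv (Equiv.embeddingCongr (Equiv.refl _) σ) _ _ fun I => rfl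

variable [MeasurableSpace Z]

lemma measurable_bagAverage (hm : Measurable h) (k : ℕ) : Measurable (bagAverage h k) := by
  unfold bagAverage
  fun_prop

lemma integrable_of_mem_Icc {Ω : Type*} [MeasurableSpace Ω] {μ : Measure Ω} [IsFiniteMeasure μ]
    {f : Ω → ℝ} {a b : ℝ} (hf : Measurable f) (hab : ∀ ω, f ω ∈ Set.Icc a b) : Integrable f μ :=
  Integrable.of_mem_Icc a b hf.aemeasurable (.of_forall hab)

variable (P : Measure Z) [IsProbabilityMeasure P]

/-- The second moment of the average over all bags, for `k` i.i.d. data points. -/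
noncomputable def bagAverageSq (h : (Fin N → Z) → ℝ) (k : ℕ) : ℝ :=
  ∫ z, bagAverage h k z ^ 2 ∂(Measure.pi fun _ : Fin k => P)

/-- Permutations act transitively on bags, and both the i.i.d. law and the full average are
invariant under them. -/
lemma integral_comp_bag_mul_bagAverage (hm : Measurable h) {M : ℕ} (J J' : Bag N M) :
    ∫ z, h (fun j => z (J j)) * bagAverage h M z ∂(Measure.pi fun _ : Fin M => P)
      = ∫ z, h (fun j => z (J' j)) * bagAverage h M z ∂(Measure.pi fun _ : Fin M => P) := by
  obtain ⟨σ, hσ⟩ := Equiv.Perm.exists_smul_eq_embedding J J'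
  have hσ' : ∀ j, J' j = σ (J j) := fun j => by rw [← hσ]; rfl
  rw [← integral_pi_comp_embedding P σ.toEmbedding
    (f := fun z => h (fun j => z (J j)) * bagAverage h M z)
    ((hm.comp (by fun_prop)).mul (measurable_bagAverage hm M))]
  simp only [Equiv.coe_toEmbedding, bagAverage_comp_perm, hσ']

/-- The orthogonality relation behind the projection, without conditional expectations: every bag
has the same correlation with the full average, so any average of bags has it too, including the
full average itself. -/
lemma integral_bagAverage_mul_bagAverage (hm : Measurable h)
    (h01 : ∀ z, h z ∈ Set.Icc (0 : ℝ) 1) {k M : ℕ} (hNk : N ≤ k) (e : Fin k ↪ Fin M) :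
    ∫ z, bagAverage h k (fun i => z (e i)) * bagAverage h M z ∂(Measure.pi fun _ : Fin M => P)
      = bagAverageSq P h M := by
  let J₀ : Bag N M := (Fin.castLEEmb hNk).trans e
  have key : ∀ {l : ℕ} (e' : Fin l ↪ Fin M), N ≤ l →
      ∫ z, bagAverage h l (fun i => z (e' i)) * bagAverage h M z ∂(Measure.pi fun _ : Fin M => P)
        = ∫ z, h (fun j => z (J₀ j)) * bagAverage h M z ∂(Measure.pi fun _ : Fin M => P) := by
    intro l e' hl
    have hpos : (0 : ℝ) < (l.descFactorial N : ℝ) := by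
      exact_mod_cast Nat.descFactorial_pos.2 hl
    have h1 : ∀ z : Fin M → Z, bagAverage h l (fun i => z (e' i)) * bagAverage h M z
        = (∑ I : Bag N l, h (fun j => z ((I.trans e') j)) * bagAverage h M z)
          / (l.descFactorial N : ℝ) := by
      intro z
      rw [← Finset.sum_mul, mul_div_right_comm]
      rfl
    simp only [h1]
    rw [integral_div, integral_finsetSum]
    · simp only [fun I : Bag N l => integral_comp_bag_mul_bagAverage P hm (I.trans e') J₀]
      rw [Finset.sum_const, Finset.card_univ, Fintype.card_embedding_eq]
      simp only [Fintype.card_fin, nsmul_eq_mul]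
      field_simp
    · intro I _
      refine integrable_of_mem_Icc (a := 0) (b := 1)
        ((hm.comp (by fun_prop)).mul (measurable_bagAverage hm M)) fun z => ?_
      have u := h01 fun j => z ((I.trans e') j)
      have v := bagAverage_mem_Icc h01 M z
      exact ⟨mul_nonneg u.1 v.1, mul_le_one₀ u.2 v.1 v.2⟩
  have hNM : N ≤ M := by simpa using Fintype.card_le_of_embedding J₀
  -- The identity embedding turns the common value into the second moment of the full average.
  rw [key e hNk, ← key (Function.Embedding.refl _) hNM]
  simp only [bagAverageSq, sq, Function.Embedding.refl_apply]

/-- Enlarging the data set changes the average over all bags by the decrease of its second moment,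
in mean square. -/
lemma integral_sq_bagAverage_sub (hm : Measurable h)
    (h01 : ∀ z, h z ∈ Set.Icc (0 : ℝ) 1) {k M : ℕ} (hNk : N ≤ k) (e : Fin k ↪ Fin M) :
    ∫ z, (bagAverage h k (fun i => z (e i)) - bagAverage h M z) ^ 2
        ∂(Measure.pi fun _ : Fin M => P)
      = bagAverageSq P h k - bagAverageSq P h M := by
  have mk := measurable_bagAverage hm k
  have mM := measurable_bagAverage hm M
  have me : Measurable fun z : Fin M → Z => bagAverage h k (fun i => z (e i)) :=
    mk.comp (by fun_prop)
  have uk : ∀ z : Fin M → Z, _ := fun z => bagAverage_mem_Icc h01 k (fun i => z (e i))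
  have uM : ∀ z : Fin M → Z, _ := bagAverage_mem_Icc h01 M
  have i1 : Integrable (fun z : Fin M → Z => bagAverage h k (fun i => z (e i)) ^ 2)
      (Measure.pi fun _ : Fin M => P) :=
    integrable_of_mem_Icc (a := 0) (b := 1) (me.pow_const 2)
      fun z => ⟨sq_nonneg _, pow_le_one₀ (uk z).1 (uk z).2⟩
  have i2 : Integrable (fun z : Fin M → Z => bagAverage h M z ^ 2)
      (Measure.pi fun _ : Fin M => P) :=
    integrable_of_mem_Icc (a := 0) (b := 1) (mM.pow_const 2)
      fun z => ⟨sq_nonneg _, pow_le_one₀ (uM z).1 (uM z).2⟩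
  have i3 : Integrable (fun z : Fin M → Z => bagAverage h k (fun i => z (e i)) * bagAverage h M z)
      (Measure.pi fun _ : Fin M => P) :=
    integrable_of_mem_Icc (a := 0) (b := 1) (me.mul mM)
      fun z => ⟨mul_nonneg (uk z).1 (uM z).1, mul_le_one₀ (uk z).2 (uM z).1 (uM z).2⟩
  have h1 : ∀ z : Fin M → Z, (bagAverage h k (fun i => z (e i)) - bagAverage h M z) ^ 2
      = bagAverage h k (fun i => z (e i)) ^ 2 + bagAverage h M z ^ 2
        - 2 * (bagAverage h k (fun i => z (e i)) * bagAverage h M z) := fun z => by ring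
  simp only [h1]
  rw [integral_sub (by exact i1.add i2) (i3.const_mul 2), integral_add i1 i2, integral_const_mul,
    integral_bagAverage_mul_bagAverage P hm h01 hNk e]
  have h2 : ∫ z, bagAverage h k (fun i => z (e i)) ^ 2 ∂(Measure.pi fun _ : Fin M => P)
      = bagAverageSq P h k := integral_pi_comp_embedding P e (mk.pow_const 2)
  rw [h2]
  change _ + bagAverageSq P h M - _ = _
  ring

/-- All `k + 1` leave-one-out differences have this decrement as their mean square, so `k + 1` times
it is the expectation of the jackknife sum, which is bounded pointwise. -/
lemma bagAverageSq_sub_succ_le (hm : Measurable h)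
    (h01 : ∀ z, h z ∈ Set.Icc (0 : ℝ) 1) {k : ℕ} (hk : 1 ≤ k) (hNk : N ≤ k) :
    bagAverageSq P h k - bagAverageSq P h (k + 1) ≤ 1 / (4 * k) * (N / (k + 1 - N)) := by
  have h1 : ∀ i : Fin (k + 1), ∫ z, (bagAverage h k (fun l => z (i.succAbove l))
      - bagAverage h (k + 1) z) ^ 2 ∂(Measure.pi fun _ : Fin (k + 1) => P)
      = bagAverageSq P h k - bagAverageSq P h (k + 1) :=
    fun i => integral_sq_bagAverage_sub P hm h01 hNk i.succAboveEmb
  have mi : ∀ i : Fin (k + 1), Measurable fun z : Fin (k + 1) → Z =>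
      (bagAverage h k (fun l => z (i.succAbove l)) - bagAverage h (k + 1) z) ^ 2 := fun i =>
    (((measurable_bagAverage hm k).comp (by fun_prop)).sub
      (measurable_bagAverage hm (k + 1))).pow_const 2
  have int : ∀ i : Fin (k + 1), Integrable (fun z : Fin (k + 1) → Z =>
      (bagAverage h k (fun l => z (i.succAbove l)) - bagAverage h (k + 1) z) ^ 2)
      (Measure.pi fun _ : Fin (k + 1) => P) := fun i => by
    refine integrable_of_mem_Icc (a := 0) (b := 1) (mi i) fun z => ⟨sq_nonneg _, ?_⟩
    have u := bagAverage_mem_Icc h01 k (fun l => z (i.succAbove l))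
    have v := bagAverage_mem_Icc h01 (k + 1) z
    rw [sq_le_one_iff_abs_le_one, abs_le]
    constructor <;> linarith [u.1, u.2, v.1, v.2]
  have h2 : ∀ z : Fin (k + 1) → Z, ∑ i : Fin (k + 1),
      (bagAverage h k (fun l => z (i.succAbove l)) - bagAverage h (k + 1) z) ^ 2
      ≤ (k + 1) * N / (4 * k * (k + 1 - N)) := by
    intro z
    -- Centering at `1/2` makes the squares at most `1/4`; the shift cancels in the difference of
    -- two averages.
    have h3 := Bag.sum_sq_jackknife_le hk hNk
      (fun J : Bag N (k + 1) => h (fun j => z (J j)) - 1 / 2) fun J => by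
        have := h01 fun j => z (J j)
        nlinarith [this.1, this.2]
    refine le_of_eq_of_le (Finset.sum_congr rfl fun i _ => ?_) h3
    have p1 : (0 : ℝ) < (k.descFactorial N : ℝ) := by
      exact_mod_cast Nat.descFactorial_pos.2 hNk
    have p2 : (0 : ℝ) < ((k + 1).descFactorial N : ℝ) := by
      exact_mod_cast Nat.descFactorial_pos.2 (hNk.trans k.le_succ)
    rw [← Bag.sum_comp_succAbove]
    simp only [Finset.sum_sub_distrib, Finset.sum_const, Finset.card_univ,
      Fintype.card_embedding_eq, Fintype.card_fin, nsmul_eq_mul, bagAverage, sub_div]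
    rw [mul_div_cancel_left₀ _ p1.ne', mul_div_cancel_left₀ _ p2.ne', sub_sub_sub_cancel_right]
    rfl
  have h4 : (k + 1) * (bagAverageSq P h k - bagAverageSq P h (k + 1))
      ≤ (k + 1) * N / (4 * k * (k + 1 - N)) := by
    calc (k + 1) * (bagAverageSq P h k - bagAverageSq P h (k + 1))
        = ∫ z, ∑ i : Fin (k + 1), (bagAverage h k (fun l => z (i.succAbove l))
          - bagAverage h (k + 1) z) ^ 2 ∂(Measure.pi fun _ : Fin (k + 1) => P) := by
          rw [integral_finsetSum _ fun i _ => int i]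
          simp only [h1, Finset.sum_const, Finset.card_univ, Fintype.card_fin, nsmul_eq_mul]
          push_cast
          rfl
      _ ≤ ∫ _z, ((k : ℝ) + 1) * N / (4 * k * (k + 1 - N)) ∂(Measure.pi fun _ : Fin (k + 1) => P) :=
          integral_mono (integrable_finsetSum _ fun i _ => int i) (integrable_const _) h2
      _ = _ := by simp
  have hk1 : (0 : ℝ) < k + 1 := by positivity
  refine le_of_mul_le_mul_left (h4.trans_eq ?_) hk1
  rw [mul_div_assoc, div_mul_div_comm, one_mul]

/-- Telescoping: the one-step bound decreases with the sample size, so each of the `m` steps costs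
at most the one at `n`. -/
lemma bagAverageSq_sub_add_le (hm : Measurable h)
    (h01 : ∀ z, h z ∈ Set.Icc (0 : ℝ) 1) {n : ℕ} (hn : 1 ≤ n) (hNn : N ≤ n) (m : ℕ) :
    bagAverageSq P h n - bagAverageSq P h (n + m) ≤ m / (4 * n) * (N / (n + 1 - N)) := by
  induction m with
  | zero => simp
  | succ m ih =>
    have h1 := bagAverageSq_sub_succ_le P hm h01 (k := n + m) (by omega) (by omega)
    have hn' : (1 : ℝ) ≤ n := by exact_mod_cast hn
    have hNn' : (N : ℝ) ≤ n := by exact_mod_cast hNn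
    have h2 : 1 / (4 * ((n + m : ℕ) : ℝ)) * (N / (((n + m : ℕ) : ℝ) + 1 - N))
        ≤ 1 / (4 * n) * (N / (n + 1 - N)) := by
      push_cast
      have : (0 : ℝ) < n + 1 - N := by linarith
      have hm0 : (0 : ℝ) ≤ m := Nat.cast_nonneg m
      have : (0 : ℝ) ≤ N / (n + m + 1 - N) := div_nonneg (Nat.cast_nonneg N) (by linarith)
      gcongr <;> linarith
    have h3 : ((m + 1 : ℕ) : ℝ) / (4 * n) * (N / (n + 1 - N))
        = m / (4 * n) * (N / (n + 1 - N)) + 1 / (4 * n) * (N / (n + 1 - N)) := by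
      push_cast; ring
    rw [h3, ← add_assoc n m 1]
    linarith

end BagAverage

/-! ### Monte Carlo error and decomposition of the stability integral. -/

/-- The first absolute moment is at most the square root of any bound on the second moment. -/
lemma lintegral_abs_le_sqrt {Ω : Type*} [MeasurableSpace Ω] {μ : Measure Ω}
    [IsProbabilityMeasure μ] {f : Ω → ℝ} (hf : MemLp f 2 μ) {c : ℝ}
    (hc : ∫ ω, f ω ^ 2 ∂μ ≤ c) :
    ∫⁻ ω, ENNReal.ofReal |f ω| ∂μ ≤ ENNReal.ofReal (√c) := by
  rw [← ofReal_integral_eq_lintegral_ofReal (hf.integrable one_le_two).abs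
    (.of_forall fun ω => abs_nonneg _)]
  refine ENNReal.ofReal_le_ofReal (Real.le_sqrt_of_sq_le ?_)
  have h1 := variance_eq_sub (μ := μ) (X := fun ω => |f ω|) hf.abs
  have h2 := variance_nonneg (fun ω => |f ω|) μ
  simp only [Pi.pow_apply, sq_abs] at h1
  linarith

/-- The mean squared Monte Carlo error of an average of `B` independent draws. -/
lemma integral_sq_average_sub_le {α : Type*} [MeasurableSpace α] (ν : Measure α)
    [IsProbabilityMeasure ν] {f : α → ℝ} (hf : Measurable f)
    (h01 : ∀ a, f a ∈ Set.Icc (0 : ℝ) 1) {B : ℕ} (hB : 1 ≤ B) :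
    ∫ I : Fin B → α, ((1 / (B : ℝ)) * ∑ b, f (I b) - ∫ a, f a ∂ν) ^ 2 ∂(Measure.pi fun _ => ν)
      ≤ 1 / (4 * (B : ℝ)) := by
  have hB' : (0 : ℝ) < B := by exact_mod_cast hB
  have hL : MemLp f 2 ν := memLp_of_bounded (.of_forall h01) hf.aestronglyMeasurable 2
  have hv := variance_sum_pi (μ := fun _ : Fin B => ν) (X := fun _ => f) fun _ => hL
  -- Popoviciu's inequality: a variable in `[0,1]` has variance at most `1/4`.
  have hle := variance_le_sq_of_bounded (μ := ν) (.of_forall h01) hf.aemeasurable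
  have mp : ∀ b : Fin B, MeasurePreserving (Function.eval b)
      (Measure.pi fun _ : Fin B => ν) ν := measurePreserving_eval fun _ : Fin B => ν
  have hint : ∀ b : Fin B, ∫ I : Fin B → α, f (I b) ∂(Measure.pi fun _ => ν) = ∫ a, f a ∂ν := by
    intro b
    conv_rhs => rw [← (mp b).map_eq]
    rw [integral_map (mp b).measurable.aemeasurable hf.aestronglyMeasurable]
  have hmean : ∫ I : Fin B → α, ∑ b, f (I b) ∂(Measure.pi fun _ => ν) = B * ∫ a, f a ∂ν := by
    rw [integral_finsetSum _ fun b _ => by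
      exact (mp b).integrable_comp_of_integrable (hL.integrable one_le_two)]
    simp [hint]
  rw [variance_eq_integral (by fun_prop)] at hv
  simp only [Finset.sum_apply, hmean, Finset.sum_const, Finset.card_univ, Fintype.card_fin,
    nsmul_eq_mul] at hv
  calc ∫ I : Fin B → α, ((1 / (B : ℝ)) * ∑ b, f (I b) - ∫ a, f a ∂ν) ^ 2 ∂(Measure.pi fun _ => ν)
      = ∫ I : Fin B → α, (1 / (B : ℝ)) ^ 2 * (∑ b, f (I b) - B * ∫ a, f a ∂ν) ^ 2
          ∂(Measure.pi fun _ => ν) := by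
        refine integral_congr_ae (.of_forall fun I => ?_)
        field_simp
    _ = (1 / (B : ℝ)) ^ 2 * (B * Var[f; ν]) := by rw [integral_const_mul, hv]
    _ ≤ (1 / (B : ℝ)) ^ 2 * (B * ((1 - 0) / 2) ^ 2) := by gcongr
    _ = 1 / (4 * B) := by field_simp; norm_num

lemma lintegral_prod_comp_snd_le {Ω S S' : Type*} [MeasurableSpace Ω] [MeasurableSpace S]
    [MeasurableSpace S'] (ρ : Measure Ω) [IsProbabilityMeasure ρ] (π : Measure S) [SFinite π]
    {p : S → S'} (hp : Measurable p) {F : Ω → S' → ℝ≥0∞} (hF : Measurable (Function.uncurry F))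
    {c : ℝ≥0∞} (hc : ∀ w, ∫⁻ s, F w s ∂(π.map p) ≤ c) :
    ∫⁻ ω, F ω.1 (p ω.2) ∂(ρ.prod π) ≤ c := by
  rw [lintegral_prod _ (by
    exact (hF.comp (measurable_fst.prodMk (hp.comp measurable_snd))).aemeasurable)]
  calc ∫⁻ w, ∫⁻ s, F w (p s) ∂π ∂ρ ≤ ∫⁻ _w, c ∂ρ := lintegral_mono fun w => by
        rw [← lintegral_map (f := F w) (by
          exact hF.comp (measurable_const.prodMk measurable_id)) hp]
        exact hc w
    _ = c := by simp

/-- Triangle inequality through `u₁` and `u₂`, which do not see the seeds. Each outer term involves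
a single seed, so only the marginals of `π` matter and the coupling is free. -/
lemma lintegral_prod_abs_sub_le {Ω S₁ S₂ : Type*} [MeasurableSpace Ω] [MeasurableSpace S₁]
    [MeasurableSpace S₂] (ρ : Measure Ω) [IsProbabilityMeasure ρ] (π : Measure (S₁ × S₂))
    [IsProbabilityMeasure π] {f₁ : Ω → S₁ → ℝ} {f₂ : Ω → S₂ → ℝ} {u₁ u₂ : Ω → ℝ}
    (mf₁ : Measurable (Function.uncurry f₁)) (mf₂ : Measurable (Function.uncurry f₂))
    (mu₁ : Measurable u₁) (mu₂ : Measurable u₂) {c₁ c₂ c : ℝ≥0∞}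
    (h₁ : ∀ w, ∫⁻ s, ENNReal.ofReal |f₁ w s - u₁ w| ∂(π.map Prod.fst) ≤ c₁)
    (h₂ : ∀ w, ∫⁻ s, ENNReal.ofReal |f₂ w s - u₂ w| ∂(π.map Prod.snd) ≤ c₂)
    (hu : ∫⁻ w, ENNReal.ofReal |u₁ w - u₂ w| ∂ρ ≤ c) :
    ∫⁻ ω, ENNReal.ofReal |f₁ ω.1 ω.2.1 - f₂ ω.1 ω.2.2| ∂(ρ.prod π) ≤ c₁ + c + c₂ := by
  have mF₁ : Measurable (Function.uncurry fun w I => ENNReal.ofReal |f₁ w I - u₁ w|) :=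
    (mf₁.sub (mu₁.comp measurable_fst)).abs.ennreal_ofReal
  have mF₂ : Measurable (Function.uncurry fun w I => ENNReal.ofReal |f₂ w I - u₂ w|) :=
    (mf₂.sub (mu₂.comp measurable_fst)).abs.ennreal_ofReal
  have mG : Measurable fun w => ENNReal.ofReal |u₁ w - u₂ w| := (mu₁.sub mu₂).abs.ennreal_ofReal
  have t₁ := lintegral_prod_comp_snd_le ρ π measurable_fst mF₁ h₁
  have t₂ := lintegral_prod_comp_snd_le ρ π measurable_snd mF₂ h₂
  rw [← (measurePreserving_fst (μ := ρ) (ν := π)).lintegral_comp mG] at hu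
  calc ∫⁻ ω, ENNReal.ofReal |f₁ ω.1 ω.2.1 - f₂ ω.1 ω.2.2| ∂(ρ.prod π)
    _ ≤ ∫⁻ ω, (ENNReal.ofReal |f₁ ω.1 ω.2.1 - u₁ ω.1| + ENNReal.ofReal |u₁ ω.1 - u₂ ω.1|)
          + ENNReal.ofReal |f₂ ω.1 ω.2.2 - u₂ ω.1| ∂(ρ.prod π) := by
        refine lintegral_mono fun ω => ?_
        rw [← ENNReal.ofReal_add (abs_nonneg _) (abs_nonneg _),
          ← ENNReal.ofReal_add (by positivity) (abs_nonneg _)]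
        refine ENNReal.ofReal_le_ofReal ?_
        have e₁ := abs_sub_le (f₁ ω.1 ω.2.1) (u₁ ω.1) (f₂ ω.1 ω.2.2)
        have e₂ := abs_sub_le (u₁ ω.1) (u₂ ω.1) (f₂ ω.1 ω.2.2)
        rw [abs_sub_comm (f₂ ω.1 ω.2.2)]
        linarith
    _ ≤ c₁ + c + c₂ := by
        rw [lintegral_add_right _ (by
            exact mF₂.comp (measurable_fst.prodMk measurable_snd.snd)),
          lintegral_add_right _ (by exact mG.comp measurable_fst)]
        exact add_le_add (add_le_add t₁ hu) t₂

lemma integral_uniformOn_bag {N k : ℕ} (f : Bag N k → ℝ) :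
    ∫ I, f I ∂(uniformOn (Set.univ : Set (Bag N k))) = (∑ I, f I) / (k.descFactorial N : ℝ) := by
  rcases isEmpty_or_nonempty (Bag N k) with _ | _
  · simp [Subsingleton.elim (uniformOn (Set.univ : Set (Bag N k))) 0]
  have : IsProbabilityMeasure (uniformOn (Set.univ : Set (Bag N k))) :=
    isProbabilityMeasure_uniformOn Set.finite_univ Set.univ_nonempty
  rw [integral_fintype .of_finite, Finset.sum_div]
  refine Finset.sum_congr rfl fun I _ => ?_
  rw [measureReal_def, uniformOn_univ, Measure.count_singleton, Fintype.card_embedding_eq]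
  simp [div_eq_inv_mul]

/-! ### Application to the subbagged algorithm. -/

namespace RegressionAlgorithm

variable {𝒳 : Type*} [MeasurableSpace 𝒳] (𝒜 : RegressionAlgorithm 𝒳)

lemma measurable_fit_left (N : ℕ) (x : 𝒳) : Measurable fun D => 𝒜.fit N D x :=
  (𝒜.measurable_fit N).comp (measurable_id.prodMk measurable_const)

lemma measurable_bagAverage_fit (N k : ℕ) :
    Measurable fun q : (Fin k → 𝒳 × ℝ) × 𝒳 => bagAverage (fun D => 𝒜.fit N D q.2) k q.1 := by
  unfold bagAverage
  refine (Finset.measurable_sum _ fun I _ => ?_).div_const _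
  exact (𝒜.measurable_fit N).comp
    (Measurable.prodMk (by fun_prop) measurable_snd)

lemma lintegral_bag_fit_sub_bagAverage_le {N B n : ℕ} (hB : 1 ≤ B) (hNn : N ≤ n)
    (h𝒜 : ∀ (k : ℕ) (D : Fin k → 𝒳 × ℝ) (x : 𝒳), 𝒜.fit k D x ∈ Set.Icc (0 : ℝ) 1)
    (D : Fin n → 𝒳 × ℝ) (x : 𝒳) :
    ∫⁻ I, ENNReal.ofReal |(𝒜.bag N B).fit n D I x - bagAverage (fun D => 𝒜.fit N D x) n D|
      ∂((𝒜.bag N B).law n) ≤ ENNReal.ofReal (1 / (2 * √B)) := by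
  have : Nonempty (Bag N n) := ⟨Fin.castLEEmb hNn⟩
  have : IsProbabilityMeasure (uniformOn (Set.univ : Set (Bag N n))) :=
    isProbabilityMeasure_uniformOn Set.finite_univ Set.univ_nonempty
  have h1 := integral_sq_average_sub_le (uniformOn (Set.univ : Set (Bag N n)))
    (f := fun I => 𝒜.fit N (fun j => D (I j)) x) (measurable_of_finite _)
    (fun I => h𝒜 _ _ _) hB
  rw [integral_uniformOn_bag] at h1
  have h2 := lintegral_abs_le_sqrt ?_ h1
  · have h3 : √(1 / (4 * (B : ℝ))) = 1 / (2 * √B) := by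
      rw [Real.sqrt_div zero_le_one, Real.sqrt_one, Real.sqrt_mul (by norm_num),
        show (4 : ℝ) = 2 ^ 2 by norm_num, Real.sqrt_sq (by norm_num)]
    rw [h3] at h2
    exact h2
  · exact .of_discrete

end RegressionAlgorithm

theorem proposition7 {𝒳 : Type*} [MeasurableSpace 𝒳]
    (𝒜 : RegressionAlgorithm 𝒳)
    (h𝒜 : ∀ (k : ℕ) (D : Fin k → 𝒳 × ℝ) (x : 𝒳), 𝒜.fit k D x ∈ Set.Icc (0 : ℝ) 1)
    (P : Measure (𝒳 × ℝ)) [IsProbabilityMeasure P]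
    (m n N B : ℕ) (hm : 1 ≤ m) (hB : 1 ≤ B) (hN : 1 ≤ N) (hNn : N < n)
    (π : Measure ((𝒜.bag N B).Seed n × (𝒜.bag N B).Seed (n + m)))
    (hπ : (𝒜.bag N B).IsSeedCoupling n (n + m) π) :
    (𝒜.bag N B).outStability P m n π ≤
      ENNReal.ofReal
        (Real.sqrt ((m : ℝ) / (4 * (n : ℝ)) * ((N : ℝ) / ((n : ℝ) + 1 - (N : ℝ))))
          + 1 / Real.sqrt (B : ℝ)) := by
  have hπp : IsProbabilityMeasure π := by
    have := (𝒜.bag N B).prob_law n hNn.le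
    refine ⟨?_⟩
    rw [← Set.preimage_univ (f := Prod.fst), ← Measure.map_apply measurable_fst .univ, hπ.1]
    exact measure_univ
  let f₁ (w : (Fin (n + m) → 𝒳 × ℝ) × (𝒳 × ℝ)) (I : (𝒜.bag N B).Seed n) : ℝ :=
    (𝒜.bag N B).fit n (fun i => w.1 (Fin.castAdd m i)) I w.2.1
  let f₂ (w : (Fin (n + m) → 𝒳 × ℝ) × (𝒳 × ℝ)) (I : (𝒜.bag N B).Seed (n + m)) : ℝ :=
    (𝒜.bag N B).fit (n + m) w.1 I w.2.1
  let u₁ (w : (Fin (n + m) → 𝒳 × ℝ) × (𝒳 × ℝ)) : ℝ :=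
    bagAverage (fun D => 𝒜.fit N D w.2.1) n (fun i => w.1 (Fin.castAdd m i))
  let u₂ (w : (Fin (n + m) → 𝒳 × ℝ) × (𝒳 × ℝ)) : ℝ :=
    bagAverage (fun D => 𝒜.fit N D w.2.1) (n + m) w.1
  have mf₁ : Measurable (Function.uncurry f₁) := by
    refine ((𝒜.bag N B).measurable_fit n).comp (((Measurable.prodMk ?_ ?_)).prodMk ?_) <;> fun_prop
  have mf₂ : Measurable (Function.uncurry f₂) := by
    refine ((𝒜.bag N B).measurable_fit (n + m)).comp (((Measurable.prodMk ?_ ?_)).prodMk ?_) <;>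
      fun_prop
  have mu₁ : Measurable u₁ :=
    (𝒜.measurable_bagAverage_fit N n).comp
      (f := fun w : (Fin (n + m) → 𝒳 × ℝ) × (𝒳 × ℝ) => (fun i => w.1 (Fin.castAdd m i), w.2.1))
      (by fun_prop)
  have mu₂ : Measurable u₂ :=
    (𝒜.measurable_bagAverage_fit N (n + m)).comp
      (f := fun w : (Fin (n + m) → 𝒳 × ℝ) × (𝒳 × ℝ) => (w.1, w.2.1)) (by fun_prop)
  have hu : ∫⁻ w, ENNReal.ofReal |u₁ w - u₂ w| ∂((Measure.pi fun _ : Fin (n + m) => P).prod P)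
      ≤ ENNReal.ofReal (√((m : ℝ) / (4 * (n : ℝ)) * ((N : ℝ) / ((n : ℝ) + 1 - (N : ℝ))))) := by
    -- Integrating over the training data first freezes the test point, so `fun D => 𝒜.fit N D x.1`
    -- is a fixed kernel to which the second-moment bounds apply.
    rw [lintegral_prod_symm _ (by exact (mu₁.sub mu₂).abs.ennreal_ofReal.aemeasurable)]
    refine (lintegral_mono fun x => ?_).trans_eq ((lintegral_const _).trans
      (by rw [measure_univ, mul_one]))
    have hx : ∀ D, 𝒜.fit N D x.1 ∈ Set.Icc (0 : ℝ) 1 := fun D => h𝒜 N D x.1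
    have hxm := 𝒜.measurable_fit_left N x.1
    refine lintegral_abs_le_sqrt (f := fun z => u₁ (z, x) - u₂ (z, x)) ?_
      ((integral_sq_bagAverage_sub P hxm hx hNn.le
        (Fin.castAddEmb m)).trans_le (bagAverageSq_sub_add_le P hxm hx (by omega) hNn.le m))
    refine memLp_of_bounded (a := -1) (b := 1) (.of_forall fun z => ?_)
      ((mu₁.sub mu₂).comp (measurable_id.prodMk measurable_const)).aestronglyMeasurable 2
    have v₁ : u₁ (z, x) ∈ Set.Icc (0 : ℝ) 1 := bagAverage_mem_Icc hx n _
    have v₂ : u₂ (z, x) ∈ Set.Icc (0 : ℝ) 1 := bagAverage_mem_Icc hx (n + m) z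
    change -1 ≤ u₁ (z, x) - u₂ (z, x) ∧ u₁ (z, x) - u₂ (z, x) ≤ 1
    exact ⟨by linarith [v₁.1, v₂.2], by linarith [v₁.2, v₂.1]⟩
  have key := lintegral_prod_abs_sub_le ((Measure.pi fun _ : Fin (n + m) => P).prod P) π
    mf₁ mf₂ mu₁ mu₂
    (fun w => by
      rw [hπ.1]
      exact 𝒜.lintegral_bag_fit_sub_bagAverage_le hB hNn.le h𝒜 _ _)
    (fun w => by
      rw [hπ.2]
      exact 𝒜.lintegral_bag_fit_sub_bagAverage_le hB (by omega) h𝒜 _ _) hu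
  -- The two Monte Carlo errors `1/(2√B)` add up to `1/√B`.
  refine key.trans_eq ?_
  rw [← ENNReal.ofReal_add (by positivity) (by positivity),
    ← ENNReal.ofReal_add (by positivity) (by positivity)]
  congr 1
  ring
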